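/- Let $A$ be a simple unital C*-algebra, i.e. $A\neq 0$ is a complex unital C*-algebra whose only norm-closed two-sided ideals are $0$ and $A$. Suppose that $A$ has a tracial state, i.e. a positive linear functional $\tau\colon A\to\mathbb{C}$ with $\|\tau\|=1$ and $\tau(ab)=\tau(ba)$ for all $a,b\in A$. Let $B$ be a unital complex Banach algebra and let $T\colon B\to A$ be a surjective linear map such that $T(1)=1$ and $T(b)$ is invertible in $A$ for every invertible $b\in B$. Then $T$ is a Jordan homomorphism, that is, $T(a^2)=(T(a))^2$ for all $a\in B$. -/

import Mathlib

section Definitions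

open scoped ComplexOrder

/-- A unital C*-algebra is simple if it is nonzero and its only norm-closed two-sided ideals are
`0` and the whole algebra. -/
def IsSimpleCStarAlgebra (A : Type*) [CStarAlgebra A] : Prop :=
  Nontrivial A ∧ ∀ I : TwoSidedIdeal A, IsClosed (I : Set A) → I = ⊥ ∨ I = ⊤

/-- A state of a unital C*-algebra: a positive linear functional of norm `1`. -/
structure IsState {A : Type*} [CStarAlgebra A] (τ : A →L[ℂ] ℂ) : Prop where
  nonneg : ∀ a : A, 0 ≤ τ (star a * a)
  norm_eq_one : ‖τ‖ = 1

/-- A tracial state: a state `τ` with `τ (a * b) = τ (b * a)` for all `a` and `b`. -/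
structure IsTracialState {A : Type*} [CStarAlgebra A] (τ : A →L[ℂ] ℂ) : Prop
    extends IsState τ where
  map_mul_comm : ∀ a b : A, τ (a * b) = τ (b * a)

/-- A linear map is invertibility-preserving if it maps invertible elements to invertible
elements. -/
def PreservesInvertibility {B A : Type*} [Ring B] [Algebra ℂ B] [Ring A] [Algebra ℂ A]
    (T : B →ₗ[ℂ] A) : Prop :=
  ∀ b : B, IsUnit b → IsUnit (T b)

/-- A Jordan homomorphism: a linear map `T` with `T (a ^ 2) = (T a) ^ 2` for all `a`. -/
def IsJordanHomomorphism {B A : Type*} [Ring B] [Algebra ℂ B] [Ring A] [Algebra ℂ A]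
    (T : B →ₗ[ℂ] A) : Prop :=
  ∀ a : B, T (a ^ 2) = (T a) ^ 2

end Definitions

open Filter Topology

/-! `T` does not increase the spectral radius beyond the norm, so a three circles argument makes
every element of its separating space quasinilpotent, even after adding its adjoint; hence `T` is
bounded (`continuous_of_preservesInvertibility`).

For an entire `f` of exponential type with invertible values, `log det f`, with `det` the
Fuglede–Kadison determinant of the trace, has real part of at most linear growth, so it is affine
and `τ (f⁻¹ f')` is constant (`IsTracialState.logDeriv_eq`). Applied to `T (exp (z x) c exp (z y))`
and differentiated at `0`, this yields `τ (T (x y)) = τ (T x T y)`. Applying that identity to the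
maps `b ↦ T (exp (z x))⁻¹ T (exp (z x) b)` and differentiating again yields `τ (T (x²) T y) = τ ((T
x)² T y)`. Surjectivity of `T` and faithfulness of `τ`, a consequence of simplicity, finish the
proof. -/

/-! ### Spectral radius estimates and automatic continuity. -/

/-- If the powers with exponent `2 ^ k` of a norm are dominated by those of `M` for some `k`, then
they are dominated for all larger exponents. -/
lemma norm_pow_two_pow_lt_mono {A : Type*} [NormedRing A] {x : A} {M : ℝ} {k l : ℕ} (hkl : k ≤ l)
    (h : ‖x ^ 2 ^ k‖ < M ^ 2 ^ k) : ‖x ^ 2 ^ l‖ < M ^ 2 ^ l := by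
  induction l, hkl using Nat.le_induction with
  | base => exact h
  | succ l _ ih =>
    rw [pow_succ, pow_mul, pow_mul]
    calc ‖(x ^ 2 ^ l) ^ 2‖ ≤ ‖x ^ 2 ^ l‖ ^ 2 := norm_pow_le' _ two_pos
      _ < (M ^ 2 ^ l) ^ 2 := by gcongr

lemma exists_norm_pow_two_pow_lt {A : Type*} [NormedRing A] [NormedAlgebra ℂ A] [CompleteSpace A]
    {x : A} {M : ℝ} (h : spectralRadius ℂ x < ENNReal.ofReal M) :
    ∃ k : ℕ, ‖x ^ 2 ^ k‖ < M ^ 2 ^ k := by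
  have hM : 0 < M := by
    by_contra hM
    simp [ENNReal.ofReal_of_nonpos (not_lt.1 hM)] at h
  have h1 := ((spectrum.pow_norm_pow_one_div_tendsto_nhds_spectralRadius x).comp
    (tendsto_pow_atTop_atTop_of_one_lt (one_lt_two : 1 < 2))).eventually_lt_const h
  obtain ⟨k, hk⟩ := h1.exists
  refine ⟨k, ?_⟩
  simp only [Function.comp] at hk
  rw [ENNReal.ofReal_lt_ofReal_iff hM] at hk
  have h2 := pow_lt_pow_left₀ hk (by positivity) (pow_ne_zero k two_ne_zero : (2 ^ k : ℕ) ≠ 0)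
  rwa [one_div, Real.rpow_inv_natCast_pow (norm_nonneg _) (by positivity)] at h2

/-- Along exponents `2 ^ k` the strict bounds define open sets increasing with `k`, so compactness
selects a single exponent, as in Dini's theorem. -/
lemma IsCompact.exists_forall_norm_pow_two_pow_lt {A X : Type*} [NormedRing A] [TopologicalSpace X]
    {K : Set X} (hK : IsCompact K) {p : X → A} (hp : Continuous p) {M : ℝ}
    (h : ∀ z ∈ K, ∃ k : ℕ, ‖p z ^ 2 ^ k‖ < M ^ 2 ^ k) :
    ∃ k : ℕ, ∀ z ∈ K, ‖p z ^ 2 ^ k‖ < M ^ 2 ^ k := by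
  obtain ⟨k, hk⟩ := hK.elim_directed_cover (fun k : ℕ ↦ {z | ‖p z ^ 2 ^ k‖ < M ^ 2 ^ k})
    (fun k ↦ isOpen_lt (by fun_prop) continuous_const)
    (fun z hz ↦ Set.mem_iUnion.2 (h z hz))
    (directed_of_isDirected_le fun k l hkl z hz ↦ norm_pow_two_pow_lt_mono hkl hz)
  exact ⟨k, fun z hz ↦ hk hz⟩

/-- A three circles theorem for the values at `1`. -/
lemma norm_mul_self_le_of_forall_circle {A : Type*} [NormedRing A] [NormedAlgebra ℂ A]
    {q : ℂ → A} (hq : Differentiable ℂ q) {R C D : ℝ} (hR : 1 < R)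
    (hC : ∀ z : ℂ, ‖z‖ = R → ‖q z‖ ≤ C) (hD : ∀ z : ℂ, ‖z‖ = R⁻¹ → ‖q z‖ ≤ D) :
    ‖q 1 * q 1‖ ≤ C * D := by
  have hR0 : 0 < R := by linarith
  have hR1 : R⁻¹ < 1 := inv_lt_one_of_one_lt₀ hR
  set U : Set ℂ := {z | R⁻¹ < ‖z‖ ∧ ‖z‖ < R} with hU
  have hUo : IsOpen U :=
    (isOpen_lt continuous_const continuous_norm).inter (isOpen_lt continuous_norm continuous_const)
  have hUc : closure U ⊆ {z | R⁻¹ ≤ ‖z‖ ∧ ‖z‖ ≤ R} :=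
    closure_minimal (fun z hz ↦ ⟨hz.1.le, hz.2.le⟩)
      ((isClosed_le continuous_const continuous_norm).inter
        (isClosed_le continuous_norm continuous_const))
  have hUb : Bornology.IsBounded U :=
    (Metric.isBounded_ball (x := (0 : ℂ)) (r := R)).subset fun z hz ↦ by simpa using hz.2
  -- On either boundary circle one of `z`, `z⁻¹` has norm `R` and the other `R⁻¹`, so the maximum
  -- principle bounds this product at `1`.
  have hd : DiffContOnCl ℂ (fun z ↦ q z * q z⁻¹) U := by
    refine DifferentiableOn.diffContOnCl fun z hz ↦ DifferentiableAt.differentiableWithinAt ?_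
    have hz0 : z ≠ 0 := norm_pos_iff.1 ((inv_pos.2 hR0).trans_le (hUc hz).1)
    exact (hq z).mul ((hq z⁻¹).comp z (differentiableAt_inv hz0))
  have h1 : (1 : ℂ) ∈ closure U := subset_closure (by simp [hU, hR, hR1])
  have key := Complex.norm_le_of_forall_mem_frontier_norm_le hUb hd (C := C * D) ?_ h1
  · simpa using key
  intro z hz
  have hzc := hUc hz.1
  have hzU : z ∉ U := by simpa [hUo.interior_eq] using hz.2
  by_cases hzR : ‖z‖ = R
  · exact (norm_mul_le _ _).trans (mul_le_mul (hC z hzR) (hD _ (by rw [norm_inv, hzR]))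
      (norm_nonneg _) ((norm_nonneg _).trans (hC z hzR)))
  · have hzR' : ‖z‖ = R⁻¹ := by
      by_contra hne
      exact hzU ⟨lt_of_le_of_ne hzc.1 (Ne.symm hne), lt_of_le_of_ne hzc.2 hzR⟩
    rw [mul_comm C]
    exact (norm_mul_le _ _).trans (mul_le_mul (hD z hzR') (hC _ (by rw [norm_inv, hzR', inv_inv]))
      (norm_nonneg _) ((norm_nonneg _).trans (hD z hzR')))

/-- A three circles theorem for the spectral radius along an affine pencil. -/
lemma spectralRadius_sq_le_of_forall_circle {A : Type*} [NormedRing A] [NormedAlgebra ℂ A]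
    [CompleteSpace A] [NormOneClass A] {u v : A} {R C D : ℝ} (hR : 1 < R) (hC0 : 0 ≤ C)
    (hD0 : 0 ≤ D)
    (hC : ∀ z : ℂ, ‖z‖ = R → ∃ k : ℕ, ‖(u + z • v) ^ 2 ^ k‖ < C ^ 2 ^ k)
    (hD : ∀ z : ℂ, ‖z‖ = R⁻¹ → ∃ k : ℕ, ‖(u + z • v) ^ 2 ^ k‖ < D ^ 2 ^ k) :
    spectralRadius ℂ (u + v) ^ 2 ≤ ENNReal.ofReal (C * D) := by
  have hp : Continuous fun z : ℂ ↦ u + z • v := by fun_prop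
  obtain ⟨k, hk⟩ := (isCompact_sphere (0 : ℂ) R).exists_forall_norm_pow_two_pow_lt hp
    (fun z hz ↦ hC z (by simpa using hz))
  obtain ⟨l, hl⟩ := (isCompact_sphere (0 : ℂ) R⁻¹).exists_forall_norm_pow_two_pow_lt hp
    (fun z hz ↦ hD z (by simpa using hz))
  set n := 2 ^ max k l with hn
  have hn0 : n ≠ 0 := by positivity
  have key := norm_mul_self_le_of_forall_circle (q := fun z : ℂ ↦ (u + z • v) ^ n) (by fun_prop) hR
    (fun z hz ↦ (norm_pow_two_pow_lt_mono (le_max_left k l) (hk z (by simpa using hz))).le)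
    (fun z hz ↦ (norm_pow_two_pow_lt_mono (le_max_right k l) (hl z (by simpa using hz))).le)
  simp only [one_smul, ← pow_add, ← mul_pow, ← two_mul] at key
  have h2 : (spectralRadius ℂ (u + v) ^ 2) ^ n ≤ ENNReal.ofReal (C * D) ^ n := by
    rw [← pow_mul, ← ENNReal.ofReal_pow (by positivity)]
    calc spectralRadius ℂ (u + v) ^ (2 * n) ≤ spectralRadius ℂ ((u + v) ^ (2 * n)) :=
          spectrum.spectralRadius_pow_le _ _ (by positivity)
      _ ≤ ‖(u + v) ^ (2 * n)‖₊ := spectrum.spectralRadius_le_nnnorm _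
      _ ≤ ENNReal.ofReal ((C * D) ^ n) := by
          rw [← ENNReal.ofReal_coe_nnreal, coe_nnnorm]
          exact ENNReal.ofReal_le_ofReal key
  exact (ENNReal.pow_le_pow_left_iff hn0).1 h2

lemma spectralRadius_map_le_of_preservesInvertibility {A B : Type*} [NormedRing A]
    [NormedAlgebra ℂ A] [NormedRing B] [NormedAlgebra ℂ B] [CompleteSpace B]
    {T : B →ₗ[ℂ] A} (hone : T 1 = 1) (hinv : PreservesInvertibility T) (x : B) :
    spectralRadius ℂ (T x) ≤ ENNReal.ofReal ‖x‖ := by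
  refine iSup₂_le fun k hk ↦ ?_
  rw [← ENNReal.ofReal_coe_nnreal, coe_nnnorm]
  refine ENNReal.ofReal_le_ofReal (not_lt.1 fun hlt ↦ hk ?_)
  have hk0 : k ≠ 0 := norm_pos_iff.1 ((norm_nonneg x).trans_lt hlt)
  have h1 : IsUnit (1 - k⁻¹ • x) := by
    refine isUnit_one_sub_of_norm_lt_one ?_
    rw [norm_smul, norm_inv, inv_mul_lt_iff₀ (norm_pos_iff.2 hk0)]
    simpa using hlt
  have h2 : IsUnit (k • (1 - k⁻¹ • x)) := h1.smul (Units.mk0 k hk0)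
  have h3 := hinv _ h2
  rwa [smul_sub, smul_inv_smul₀ hk0, map_sub, map_smul, hone, ← Algebra.algebraMap_eq_smul_one]
    at h3

/-- Adding an element of the separating space of a spectrally contractive map preserves
quasinilpotency. -/
lemma spectralRadius_add_eq_zero_of_tendsto {A B : Type*} [NormedRing A] [NormedAlgebra ℂ A]
    [CompleteSpace A] [NormOneClass A] [NormedRing B] [NormedAlgebra ℂ B]
    {T : B →ₗ[ℂ] A} (hsurj : Function.Surjective T)
    (hT : ∀ x, spectralRadius ℂ (T x) ≤ ENNReal.ofReal ‖x‖) {w : ℕ → B} {a b : A}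
    (hw : Tendsto w atTop (𝓝 0)) (hTw : Tendsto (fun n ↦ T (w n)) atTop (𝓝 a))
    (hb : spectralRadius ℂ b = 0) : spectralRadius ℂ (b + a) = 0 := by
  obtain ⟨y, hy⟩ := hsurj (b + a)
  set K : ℝ := ‖y‖ + 1 with hK
  have hK0 : 0 < K := by positivity
  suffices H : ∀ ε : ℝ, 0 < ε → spectralRadius ℂ (b + a) ^ 2 ≤ ENNReal.ofReal (K * ε) by
    have h0 : spectralRadius ℂ (b + a) ^ 2 ≤ 0 := by
      have hlim : Tendsto (fun ε : ℝ ↦ ENNReal.ofReal (K * ε)) (𝓝[>] 0) (𝓝 0) := by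
        have : Tendsto (fun ε : ℝ ↦ ENNReal.ofReal (K * ε)) (𝓝 0) (𝓝 (ENNReal.ofReal (K * 0))) :=
          (ENNReal.continuous_ofReal.comp (continuous_const.mul continuous_id)).tendsto 0
        simpa using this.mono_left nhdsWithin_le_nhds
      exact ge_of_tendsto hlim (eventually_mem_nhdsWithin.mono fun ε hε ↦ H ε hε)
    exact pow_eq_zero_iff two_ne_zero |>.1 (le_antisymm h0 bot_le)
  intro ε hε
  obtain ⟨k, hk⟩ := exists_norm_pow_two_pow_lt (x := b) (M := ε) (by simpa [hb] using hε)
  obtain ⟨δ, hδ, hδb⟩ : ∃ δ > 0, ∀ e : A, ‖e‖ < δ → ‖(b + e) ^ 2 ^ k‖ < ε ^ 2 ^ k := by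
    have hc : ContinuousAt (fun e : A ↦ ‖(b + e) ^ 2 ^ k‖) 0 := by fun_prop
    have := hc.eventually_lt_const (u := ε ^ 2 ^ k) (by simpa using hk)
    simpa [Metric.eventually_nhds_iff] using this
  -- The pencil is `T (y - w n) + z • T (w n)`. On the large circle it is bounded through `‖y‖`,
  -- since `w n` is small; on the small circle it is close to `b`. Hence `R` depends on `δ`, and `n`
  -- on both.
  obtain ⟨R, hR, hRδ⟩ : ∃ R : ℝ, 1 < R ∧ R⁻¹ * (‖a‖ + 1) < δ / 2 := by
    have h1 : Tendsto (fun R : ℝ ↦ R⁻¹ * (‖a‖ + 1)) atTop (𝓝 (0 * (‖a‖ + 1))) :=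
      tendsto_inv_atTop_zero.mul_const _
    rw [zero_mul] at h1
    exact ((eventually_gt_atTop 1).and (h1.eventually_lt_const (by positivity))).exists
  have hR0 : 0 < R := by linarith
  have e1 : ∀ᶠ n in atTop, (1 + R) * ‖w n‖ < 1 := by
    have : Tendsto (fun n ↦ (1 + R) * ‖w n‖) atTop (𝓝 ((1 + R) * ‖(0 : B)‖)) :=
      hw.norm.const_mul _
    exact this.eventually_lt_const (by simp)
  have e2 : ∀ᶠ n in atTop, ‖a - T (w n)‖ < δ / 2 := by
    have : Tendsto (fun n ↦ ‖a - T (w n)‖) atTop (𝓝 ‖a - a‖) := (hTw.const_sub a).norm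
    exact this.eventually_lt_const (by simpa using hδ)
  have e3 : ∀ᶠ n in atTop, ‖T (w n)‖ < ‖a‖ + 1 := hTw.norm.eventually_lt_const (by simp)
  obtain ⟨n, h1, h2, h3⟩ := (e1.and (e2.and e3)).exists
  have hsum : b + a = T (y - w n) + T (w n) := by rw [← map_add, sub_add_cancel, hy]
  rw [hsum]
  refine spectralRadius_sq_le_of_forall_circle hR hK0.le hε.le (fun z hz ↦ ?_) (fun z hz ↦ ?_)
  · refine exists_norm_pow_two_pow_lt ?_
    rw [← map_smul, ← map_add]
    refine (hT _).trans_lt ((ENNReal.ofReal_lt_ofReal_iff hK0).2 ?_)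
    calc ‖y - w n + z • w n‖ ≤ ‖y‖ + ‖w n‖ + ‖z • w n‖ :=
          (norm_add_le _ _).trans (by gcongr; exact norm_sub_le _ _)
      _ = ‖y‖ + (1 + R) * ‖w n‖ := by rw [norm_smul, hz]; ring
      _ < K := by rw [hK]; gcongr
  · refine ⟨k, ?_⟩
    have : T (y - w n) + z • T (w n) = b + ((a - T (w n)) + z • T (w n)) := by
      rw [map_sub, hy]; abel
    rw [this]
    refine hδb _ ?_
    calc ‖(a - T (w n)) + z • T (w n)‖ ≤ ‖a - T (w n)‖ + R⁻¹ * ‖T (w n)‖ := by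
          refine (norm_add_le _ _).trans_eq ?_
          rw [norm_smul, hz]
      _ ≤ ‖a - T (w n)‖ + R⁻¹ * (‖a‖ + 1) := by gcongr
      _ < δ := by linarith

lemma spectralRadius_star_eq {A : Type*} [CStarAlgebra A] (a : A) :
    spectralRadius ℂ (star a) = spectralRadius ℂ a := by
  refine tendsto_nhds_unique (spectrum.pow_nnnorm_pow_one_div_tendsto_nhds_spectralRadius (star a))
    ?_
  simpa [← star_pow] using spectrum.pow_nnnorm_pow_one_div_tendsto_nhds_spectralRadius a

/-- A surjective unital invertibility-preserving map onto a C*-algebra is continuous. -/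
theorem continuous_of_preservesInvertibility {A B : Type*} [CStarAlgebra A]
    [NormedRing B] [NormedAlgebra ℂ B] [CompleteSpace B]
    {T : B →ₗ[ℂ] A} (hsurj : Function.Surjective T) (hone : T 1 = 1)
    (hinv : PreservesInvertibility T) : Continuous T := by
  cases subsingleton_or_nontrivial A
  · exact continuous_of_const fun _ _ ↦ Subsingleton.elim _ _
  have hT := spectralRadius_map_le_of_preservesInvertibility hone hinv
  refine T.continuous_of_seq_closed_graph fun u x y hu hTu ↦ ?_
  have hw : Tendsto (fun n ↦ u n - x) atTop (𝓝 0) := by simpa using hu.sub_const x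
  have hTw : Tendsto (fun n ↦ T (u n - x)) atTop (𝓝 (y - T x)) := by
    simpa using hTu.sub_const (T x)
  set a := y - T x
  have h0 : spectralRadius ℂ a = 0 := by
    simpa using spectralRadius_add_eq_zero_of_tendsto hsurj hT hw hTw (b := 0) (by simp)
  have h1 : spectralRadius ℂ (star a + a) = 0 :=
    spectralRadius_add_eq_zero_of_tendsto hsurj hT hw hTw (by rw [spectralRadius_star_eq, h0])
  have h2 : star a + a = 0 := by
    rw [(IsSelfAdjoint.star_add_self a).spectralRadius_eq_nnnorm] at h1
    simpa using h1
  -- A skew-adjoint element is normal, so quasinilpotency forces `a = 0`.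
  have h3 : star a = -a := eq_neg_of_add_eq_zero_left h2
  have : IsStarNormal a := ⟨by rw [h3]; exact (Commute.refl a).neg_left⟩
  rw [IsStarNormal.spectralRadius_eq_nnnorm] at h0
  exact sub_eq_zero.1 (by simpa using h0)

/-! ### The Fuglede–Kadison determinant through a primitive of the trace form. -/

section TraceLog

variable {A : Type*} [CStarAlgebra A]

/-- The differential form `v ↦ τ (a⁻¹ * v)`, which is the derivative of `a ↦ τ (log a)` if `τ` is a
trace. -/
noncomputable def traceLogForm (τ : A →L[ℂ] ℂ) (a : A) : A →L[ℂ] ℂ :=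
  τ ∘L ContinuousLinearMap.mul ℂ A (Ring.inverse a)

lemma hasFDerivAt_traceLogForm (τ : A →L[ℂ] ℂ) {a : A} (ha : IsUnit a) :
    HasFDerivAt (𝕜 := ℝ) (traceLogForm τ)
      (((ContinuousLinearMap.compL ℂ A A ℂ τ ∘L ContinuousLinearMap.mul ℂ A).restrictScalars ℝ) ∘L
        (-ContinuousLinearMap.mulLeftRight ℝ A (Ring.inverse a) (Ring.inverse a))) a := by
  obtain ⟨u, rfl⟩ := ha
  rw [Ring.inverse_unit]
  exact (((ContinuousLinearMap.compL ℂ A A ℂ τ ∘L ContinuousLinearMap.mul ℂ A).restrictScalars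
    ℝ).hasFDerivAt (x := Ring.inverse (u : A))).comp (u : A) (hasFDerivAt_ringInverse (𝕜 := ℝ) u)

variable [PartialOrder A] [StarOrderedRing A]

lemma convex_isStrictlyPositive : Convex ℝ {a : A | IsStrictlyPositive a} := by
  intro a ha b hb s t hs ht hst
  rcases hs.eq_or_lt with rfl | hs
  · have : t = 1 := by linarith
    simpa [this] using hb
  · exact isStrictlyPositive_add (.inl ⟨IsStrictlyPositive.smul hs ha, smul_nonneg ht hb.nonneg⟩)

/-- The form `v ↦ τ (a⁻¹ * v)` of a trace `τ` has a primitive on the positive cone. -/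
lemma exists_primitive_traceLogForm {τ : A →L[ℂ] ℂ} (hτ : ∀ a b : A, τ (a * b) = τ (b * a)) :
    ∃ Φ : A → ℂ, ∀ h : ℝ → A, (∀ t, IsStrictlyPositive (h t)) → ∀ t h', HasDerivAt h h' t →
      HasDerivAt (fun t ↦ Φ (h t)) (τ (Ring.inverse (h t) * h')) t := by
  -- Poincaré lemma on the convex positive cone: the form is closed because `τ (a⁻¹ x a⁻¹ y)` is
  -- symmetric in `x` and `y` by the trace property.
  obtain ⟨Φ, hΦ⟩ :=
    (convex_isStrictlyPositive (A := A)).exists_forall_hasFDerivWithinAt_of_hasFDerivWithinAt_symmetric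
    (fun a ha ↦ (hasFDerivAt_traceLogForm τ (IsStrictlyPositive.isUnit ha)).hasFDerivWithinAt) (by
      intro a _ x _ y _
      simp only [ContinuousLinearMap.comp_apply, neg_apply,
        ContinuousLinearMap.mulLeftRight_apply, ContinuousLinearMap.coe_restrictScalars',
        ContinuousLinearMap.compL_apply, map_neg, ContinuousLinearMap.mul_apply']
      rw [mul_assoc (Ring.inverse a * x), hτ]
      simp only [mul_assoc])
  refine ⟨Φ, fun h hh t h' hd ↦ ?_⟩
  exact ((hΦ (h t) (hh t)).restrictScalars ℝ).comp_hasDerivAt t hd (Eventually.of_forall hh)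

/-- Along the path `exp (t • log k)` from `1` to `k` the form takes the constant value `τ (log k)`.
-/
lemma primitive_traceLogForm_sub_eq {τ : A →L[ℂ] ℂ} {Φ : A → ℂ}
    (hΦ : ∀ h : ℝ → A, (∀ t, IsStrictlyPositive (h t)) → ∀ t h', HasDerivAt h h' t →
      HasDerivAt (fun t ↦ Φ (h t)) (τ (Ring.inverse (h t) * h')) t)
    {k : A} (hk : IsStrictlyPositive k) : Φ k - Φ 1 = τ (CFC.log k) := by
  let _ : NormedAlgebra ℚ A := NormedAlgebra.restrictScalars ℚ ℂ A
  set x := CFC.log k with hx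
  have hxs : IsSelfAdjoint x := IsSelfAdjoint.log
  have hsa (t : ℝ) : IsSelfAdjoint (t • x) := (IsSelfAdjoint.all t).smul hxs
  have hu (t : ℝ) : IsUnit (NormedSpace.exp (t • x)) :=
    NormedSpace.isUnit_exp (t • x)
  have hpos (t : ℝ) : IsStrictlyPositive (NormedSpace.exp (t • x)) :=
    (hu t).isStrictlyPositive (hsa t).exp_nonneg
  have hd (t : ℝ) : HasDerivAt (fun t : ℝ ↦ Φ (NormedSpace.exp (t • x)) - t • τ x) 0 t := by
    have h1 := hΦ (fun t ↦ NormedSpace.exp (t • x)) hpos t _ (hasDerivAt_exp_smul_const x t)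
    rw [Ring.inverse_mul_cancel_left _ _ (hu t)] at h1
    exact (h1.sub ((hasDerivAt_id t).smul_const (τ x))).congr_deriv (by simp)
  have h2 := is_const_of_deriv_eq_zero (fun t ↦ (hd t).differentiableAt) (fun t ↦ (hd t).deriv) 1 0
  have hk' : NormedSpace.exp x = k := CFC.exp_log k
  simp only [one_smul, zero_smul, NormedSpace.exp_zero, sub_zero, hk'] at h2
  rw [← h2]; ring

lemma ContinuousLinearMap.map_nonneg_of_map_star_mul_self_nonneg {τ : A →L[ℂ] ℂ}
    (hpos : ∀ a : A, 0 ≤ (τ (star a * a)).re) {a : A} (ha : 0 ≤ a) : 0 ≤ (τ a).re := by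
  obtain ⟨b, rfl⟩ := CStarAlgebra.nonneg_iff_eq_star_mul_self.1 ha
  exact hpos b

open scoped ComplexOrder in
lemma map_star_of_map_star_mul_self_nonneg {τ : A →L[ℂ] ℂ}
    (hpos : ∀ a : A, 0 ≤ τ (star a * a)) (a : A) : τ (star a) = star (τ a) := by
  let p : A →ₚ[ℂ] ℂ := PositiveLinearMap.mk₀ (τ : A →ₗ[ℂ] ℂ) fun a ha ↦ by
    obtain ⟨b, rfl⟩ := CStarAlgebra.nonneg_iff_eq_star_mul_self.1 ha
    exact hpos b
  exact map_star p a

open scoped ComplexOrder in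
lemma re_trace_log_le {τ : A →L[ℂ] ℂ} (hpos : ∀ a : A, 0 ≤ τ (star a * a)) {k : A}
    (hk : IsStrictlyPositive k) : (τ (CFC.log k)).re ≤ (τ 1).re * Real.log ‖k‖ := by
  have h1 : CFC.log k ≤ algebraMap ℝ A (Real.log ‖k‖) := by
    rw [← CFC.log_algebraMap]
    exact CFC.log_le_log (hk.isSelfAdjoint.le_algebraMap_norm_self) hk
  have h2 := ContinuousLinearMap.map_nonneg_of_map_star_mul_self_nonneg
    (fun a ↦ (Complex.le_def.1 (hpos a)).1) (sub_nonneg.2 h1)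
  rw [map_sub, Algebra.algebraMap_eq_smul_one, ← Complex.coe_smul, map_smul, Complex.sub_re,
    smul_eq_mul, Complex.re_ofReal_mul] at h2
  linarith

open scoped ComplexOrder in
/-- The bound `log (det p) ≤ log ‖p‖` for the Fuglede–Kadison determinant of a trace, where the
determinant is given by integration of the logarithmic derivative along a path. -/
lemma re_logDet_le {τ : A →L[ℂ] ℂ} (hτ : ∀ a b : A, τ (a * b) = τ (b * a))
    (hpos : ∀ a : A, 0 ≤ τ (star a * a)) {p p' : ℝ → A} {γ : ℝ → ℂ}
    (hp : ∀ t, HasDerivAt p (p' t) t) (hu : ∀ t, IsUnit (p t)) (hp0 : p 0 = 1)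
    (hγ : ∀ t, HasDerivAt γ (τ (Ring.inverse (p t) * p' t)) t) (hγ0 : γ 0 = 0) :
    (γ 1).re ≤ (τ 1).re * Real.log ‖p 1‖ := by
  obtain ⟨Φ, hΦ⟩ := exists_primitive_traceLogForm hτ
  have hsp (t : ℝ) : IsStrictlyPositive (star (p t) * p t) :=
    ((hu t).star.mul (hu t)).isStrictlyPositive (star_mul_self_nonneg _)
  -- Passing to `star p * p` moves the path into the positive cone and doubles the real part; the 2
  -- cancels against `‖star p * p‖ = ‖p‖ ^ 2`.
  have hd (t : ℝ) : HasDerivAt (fun t ↦ (Φ (star (p t) * p t)).re - 2 * (γ t).re) 0 t := by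
    have h1 := hΦ _ hsp t _ ((hp t).star.mul (hp t))
    have h2 : τ (Ring.inverse (star (p t) * p t) * (star (p' t) * p t + star (p t) * p' t)) =
        star (τ (Ring.inverse (p t) * p' t)) + τ (Ring.inverse (p t) * p' t) := by
      obtain ⟨u, hu⟩ := hu t
      rw [← hu, ← map_star_of_map_star_mul_self_nonneg hpos, ← Units.coe_star, ← Units.val_mul,
        Ring.inverse_unit, Ring.inverse_unit, mul_add, map_add, mul_inv_rev, Units.val_mul]
      congr 1
      · rw [← mul_assoc, hτ, star_mul, ← Units.coe_star, star_inv, hτ (star (p' t))]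
        simp [mul_assoc]
      · rw [mul_assoc, Units.inv_mul_cancel_left]
    rw [h2] at h1
    have h3 := (Complex.reCLM.hasFDerivAt.comp_hasDerivAt t h1).sub
      ((Complex.reCLM.hasFDerivAt.comp_hasDerivAt t (hγ t)).const_mul 2)
    refine h3.congr_deriv ?_
    simp
    ring
  have h2 := is_const_of_deriv_eq_zero (fun t ↦ (hd t).differentiableAt) (fun t ↦ (hd t).deriv) 1 0
  simp only [hp0, hγ0, star_one, mul_one, Complex.zero_re, mul_zero, sub_zero] at h2
  have h3 := congrArg Complex.re (primitive_traceLogForm_sub_eq hΦ (hsp 1))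
  have h4 := re_trace_log_le hpos (hsp 1)
  rw [CStarRing.norm_star_mul_self, ← sq, Real.log_pow] at h4
  rw [Complex.sub_re] at h3
  push_cast at h4
  linarith

end TraceLog

/-! ### Rigidity of entire functions of exponential type. -/

/-- An entire function whose real part grows at most linearly is affine. -/
lemma deriv_eq_of_re_le {G : ℂ → ℂ} (hG : Differentiable ℂ G) (hG0 : G 0 = 0) {a b : ℝ}
    (hb : 0 ≤ b) (h : ∀ z, (G z).re ≤ a + b * ‖z‖) (z : ℂ) :
    deriv G z = deriv G 0 := by
  obtain ⟨a', ha'a, ha'⟩ : ∃ a' : ℝ, a ≤ a' ∧ 0 < a' :=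
    ⟨max a 1, le_max_left _ _, lt_max_of_lt_right one_pos⟩
  refine hG.deriv.apply_eq_apply_of_bounded ?_ _ _
  refine (Metric.isBounded_closedBall (x := (0 : ℂ)) (r := 2 * (a' + 4 * b))).subset ?_
  rintro _ ⟨z, rfl⟩
  rw [mem_closedBall_zero_iff]
  -- The circle of radius `R` about `z` lies in the ball of radius `2 * R` about `0`, so
  -- Borel–Carathéodory on radius `4 * R` bounds `G` there by `2 * (a' + 4 * b * R)`. Cauchy's
  -- estimate divides by `R ≥ 1`.
  set R := ‖z‖ + 1 with hR
  have hR1 : 1 ≤ R := by simp [hR]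
  have hR0 : 0 < R := by linarith
  have h1 : ∀ w ∈ Metric.sphere z R, ‖G w‖ ≤ 2 * (a' + 4 * b * R) := by
    intro w hw
    have hw2 : ‖w‖ ≤ 2 * R := by
      have : ‖w‖ ≤ ‖w - z‖ + ‖z‖ := norm_le_norm_sub_add w z
      rw [mem_sphere_iff_norm.1 hw] at this
      linarith
    have h2 := Complex.borelCaratheodory_zero (M := a' + 4 * b * R) (R := 4 * R) (f := G) (z := w)
      (by positivity) hG.differentiableOn ?_ (by positivity) (by simp; linarith) hG0
    · refine h2.trans ?_
      rw [div_le_iff₀ (by linarith)]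
      gcongr
      linarith
    · intro x hx
      have hx' : ‖x‖ < 4 * R := by simpa using hx
      have : b * ‖x‖ ≤ b * (4 * R) := by gcongr
      have := h x
      simp only [Set.mem_ofPred_eq]
      linarith
  refine (Complex.norm_deriv_le_of_forall_mem_sphere_norm_le hR0 hG.diffContOnCl h1).trans ?_
  rw [div_le_iff₀ hR0]
  nlinarith

/-- The logarithmic derivative, under a tracial state, of an entire function of exponential type
with invertible values is constant. -/
theorem IsTracialState.logDeriv_eq {A : Type*} [CStarAlgebra A] {τ : A →L[ℂ] ℂ}
    (hτ : IsTracialState τ) {f : ℂ → A} (hf : Differentiable ℂ f) (hu : ∀ z, IsUnit (f z))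
    {C c : ℝ} (hc : 0 ≤ c) (hC : ∀ z, ‖f z‖ ≤ C * Real.exp (c * ‖z‖)) (z : ℂ) :
    τ (Ring.inverse (f z) * deriv f z) = τ (Ring.inverse (f 0) * deriv f 0) := by
  let _ : PartialOrder A := CStarAlgebra.spectralOrder A
  have _ : StarOrderedRing A := CStarAlgebra.spectralOrderedRing A
  cases subsingleton_or_nontrivial A
  · exact congrArg τ (Subsingleton.elim _ _)
  have hg : Differentiable ℂ fun z ↦ τ (Ring.inverse (f z) * deriv f z) := fun z ↦
    τ.differentiableAt.comp z
      (((differentiableAt_inverse (hu z)).comp z (hf z)).mul hf.deriv.differentiableAt)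
  obtain ⟨G, hG0, hG⟩ := hg.isExactOn_univ.with_val_at 0 0
  -- Normalising by `f 0` makes every path start at `1` and leaves the logarithmic derivative
  -- unchanged.
  set v := Ring.inverse (f 0) with hv
  have hvu : IsUnit v := (hu 0).ringInverse
  have hpu (z : ℂ) : IsUnit (v * f z) := hvu.mul (hu z)
  have hv0 : v * f 0 = 1 := Ring.inverse_mul_cancel _ (hu 0)
  have hG' (z : ℂ) : deriv G z = τ (Ring.inverse (f z) * deriv f z) := (hG z trivial).deriv
  have key (z : ℂ) : (G z).re ≤ (τ 1).re * Real.log ‖v * f z‖ := by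
    have hl (t : ℝ) : HasDerivAt (fun t : ℝ ↦ (t : ℂ) * z) z t := by
      simpa using (Complex.ofRealCLM.hasDerivAt (x := t)).mul_const z
    have h1 := re_logDet_le hτ.map_mul_comm hτ.nonneg (p := fun t : ℝ ↦ v * f (t * z))
      (p' := fun t : ℝ ↦ v * (z • deriv f (t * z))) (γ := fun t : ℝ ↦ G (t * z))
      (fun t ↦ ((hf (t * z)).hasDerivAt.scomp t (hl t)).const_mul v) (fun t ↦ hpu _)
      (by simpa using hv0) (fun t ↦ ?_) (by simpa using hG0)
    · simpa using h1
    · refine ((hG (t * z) trivial).scomp t (hl t)).congr_deriv ?_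
      obtain ⟨w, hw⟩ := hvu
      obtain ⟨u, hu⟩ := hu (t * z)
      rw [← hw, ← hu, ← Units.val_mul, Ring.inverse_unit, Ring.inverse_unit]
      simp [mul_assoc]
  have hτ1 : 0 ≤ (τ 1).re := by simpa using (Complex.le_def.1 (hτ.nonneg 1)).1
  have hle (z : ℂ) : ‖v * f z‖ ≤ ‖v‖ * C * Real.exp (c * ‖z‖) :=
    (norm_mul_le _ _).trans (by rw [mul_assoc]; gcongr; exact hC z)
  have hD : 0 < ‖v‖ * C := by
    have h1 := hle 0
    simp only [hv0, norm_zero, mul_zero, Real.exp_zero, mul_one] at h1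
    exact (norm_pos_iff.2 one_ne_zero).trans_le h1
  rw [← hG', ← hG']
  refine deriv_eq_of_re_le (fun z ↦ (hG z trivial).differentiableAt) hG0
    (a := (τ 1).re * Real.log (‖v‖ * C)) (b := (τ 1).re * c) (by positivity) (fun z ↦ ?_) z
  refine (key z).trans ?_
  rw [mul_assoc, ← mul_add]
  gcongr
  rw [← Real.log_exp (c * ‖z‖), ← Real.log_mul hD.ne' (Real.exp_ne_zero _)]
  exact Real.log_le_log (norm_pos_iff.2 (hpu z).ne_zero) (hle z)

/-! ### Trace identities for the map. -/

lemma norm_exp_le_norm_one_mul_exp {B : Type*} [NormedRing B] [NormedAlgebra ℂ B] [CompleteSpace B]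
    (x : B) : ‖NormedSpace.exp x‖ ≤ ‖(1 : B)‖ * Real.exp ‖x‖ := by
  have hpow (n : ℕ) : ‖x ^ n‖ ≤ ‖(1 : B)‖ * ‖x‖ ^ n := by
    induction n with
    | zero => simp
    | succ n ih =>
      rw [pow_succ, pow_succ, ← mul_assoc]
      exact (norm_mul_le _ _).trans (by gcongr)
  have h1 : HasSum (fun n : ℕ ↦ ‖(1 : B)‖ * (‖x‖ ^ n / n.factorial)) (‖(1 : B)‖ * Real.exp ‖x‖) := by
    rw [Real.exp_eq_exp_ℝ]
    exact (NormedSpace.expSeries_div_hasSum_exp ‖x‖).mul_left _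
  rw [NormedSpace.exp_eq_tsum ℂ]
  refine tsum_of_norm_bounded h1 fun n ↦ ?_
  rw [norm_smul, norm_inv, Complex.norm_natCast, inv_mul_le_iff₀ (by positivity)]
  refine (hpow n).trans_eq ?_
  field_simp

section

variable {A B : Type*} [CStarAlgebra A] [NormedRing B] [NormedAlgebra ℂ B] [CompleteSpace B]
  {τ : A →L[ℂ] ℂ} {T : B →L[ℂ] A}

lemma isUnit_exp_smul (z : ℂ) (x : B) : IsUnit (NormedSpace.exp (z • x)) := by
  let _ : NormedAlgebra ℚ B := NormedAlgebra.restrictScalars ℚ ℂ B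
  exact NormedSpace.isUnit_exp _

lemma IsTracialState.logDeriv_map_exp_eq (hτ : IsTracialState τ)
    (hinv : PreservesInvertibility (T : B →ₗ[ℂ] A)) (x y : B) {c : B} (hc : IsUnit c) (z : ℂ) :
    τ (Ring.inverse (T (NormedSpace.exp (z • x) * c * NormedSpace.exp (z • y))) *
      T (NormedSpace.exp (z • x) * x * c * NormedSpace.exp (z • y) +
        NormedSpace.exp (z • x) * c * (NormedSpace.exp (z • y) * y))) =
      τ (Ring.inverse (T c) * T (x * c + c * y)) := by
  set f : ℂ → A := fun z ↦ T (NormedSpace.exp (z • x) * c * NormedSpace.exp (z • y)) with hf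
  have hd (z : ℂ) : HasDerivAt f (T (NormedSpace.exp (z • x) * x * c * NormedSpace.exp (z • y) +
      NormedSpace.exp (z • x) * c * (NormedSpace.exp (z • y) * y))) z :=
    T.hasFDerivAt.comp_hasDerivAt z
      (((hasDerivAt_exp_smul_const x z).mul_const c).mul (hasDerivAt_exp_smul_const y z))
  have hu (z : ℂ) : IsUnit (f z) :=
    hinv _ (((isUnit_exp_smul z x).mul hc).mul (isUnit_exp_smul z y))
  have hC (z : ℂ) : ‖f z‖ ≤ (‖T‖ * (‖(1 : B)‖ * ‖c‖ * ‖(1 : B)‖)) *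
      Real.exp ((‖x‖ + ‖y‖) * ‖z‖) := by
    calc ‖f z‖ ≤ ‖T‖ * ‖NormedSpace.exp (z • x) * c * NormedSpace.exp (z • y)‖ := T.le_opNorm _
      _ ≤ ‖T‖ * (‖NormedSpace.exp (z • x)‖ * ‖c‖ * ‖NormedSpace.exp (z • y)‖) := by
          gcongr
          exact (norm_mul_le _ _).trans (by gcongr; exact norm_mul_le _ _)
      _ ≤ ‖T‖ * (‖(1 : B)‖ * Real.exp ‖z • x‖ * ‖c‖ * (‖(1 : B)‖ * Real.exp ‖z • y‖)) := by
          gcongr <;> exact norm_exp_le_norm_one_mul_exp _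
      _ = _ := by
          rw [norm_smul, norm_smul, add_mul, Real.exp_add, mul_comm ‖x‖, mul_comm ‖y‖]
          ring
  have h := hτ.logDeriv_eq (fun z ↦ (hd z).differentiableAt) hu (by positivity) hC z
  rw [(hd z).deriv, (hd 0).deriv] at h
  simpa [hf] using h

lemma hasDerivAt_map_exp_mul (x b : B) :
    HasDerivAt (fun z : ℂ ↦ T (NormedSpace.exp (z • x) * b)) (T (x * b)) 0 := by
  exact (T.hasFDerivAt.comp_hasDerivAt (0 : ℂ)
    ((hasDerivAt_exp_smul_const x 0).mul_const b)).congr_deriv (by simp)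

lemma hasDerivAt_map_mul_exp (x b : B) :
    HasDerivAt (fun z : ℂ ↦ T (b * NormedSpace.exp (z • x))) (T (b * x)) 0 := by
  exact (T.hasFDerivAt.comp_hasDerivAt (0 : ℂ)
    ((hasDerivAt_exp_smul_const x 0).const_mul b)).congr_deriv (by simp)

lemma hasDerivAt_inverse_map_exp (hone : T 1 = 1) (x : B) :
    HasDerivAt (fun z : ℂ ↦ Ring.inverse (T (NormedSpace.exp (z • x)))) (-T x) 0 := by
  have h1 : HasDerivAt (fun z : ℂ ↦ T (NormedSpace.exp (z • x))) (T x) 0 := by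
    simpa using hasDerivAt_map_exp_mul (T := T) x 1
  have h2 : HasFDerivAt Ring.inverse
      (-ContinuousLinearMap.mulLeftRight ℂ A ((1 : Aˣ)⁻¹ : Aˣ) ((1 : Aˣ)⁻¹ : Aˣ))
      (T (NormedSpace.exp ((0 : ℂ) • x))) := by
    simpa [hone] using hasFDerivAt_ringInverse (𝕜 := ℂ) (1 : Aˣ)
  refine (h2.comp_hasDerivAt (0 : ℂ) h1).congr_deriv ?_
  simp

/-- A unital invertibility-preserving bounded map is multiplicative under a tracial state. -/
theorem IsTracialState.map_mul_eq (hτ : IsTracialState τ) (hone : T 1 = 1)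
    (hinv : PreservesInvertibility (T : B →ₗ[ℂ] A)) (x y : B) : τ (T (x * y)) = τ (T x * T y) := by
  -- The middle factor is frozen at `c = exp (z • y)` for the given `z`; only the exponential of `x`
  -- varies. In `hy` the roles are exchanged.
  have hx (z : ℂ) : τ (Ring.inverse (T (NormedSpace.exp (z • x) * NormedSpace.exp (z • y))) *
      T (NormedSpace.exp (z • x) * x * NormedSpace.exp (z • y))) =
      τ (Ring.inverse (T (NormedSpace.exp (z • y))) * T (x * NormedSpace.exp (z • y))) := by
    simpa using hτ.logDeriv_map_exp_eq hinv x 0 (isUnit_exp_smul z y) z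
  have hy (z : ℂ) : τ (Ring.inverse (T (NormedSpace.exp (z • x) * NormedSpace.exp (z • y))) *
      T (NormedSpace.exp (z • x) * (NormedSpace.exp (z • y) * y))) =
      τ (Ring.inverse (T (NormedSpace.exp (z • x))) * T (NormedSpace.exp (z • x) * y)) := by
    simpa using hτ.logDeriv_map_exp_eq hinv 0 y (isUnit_exp_smul z x) z
  have hxy (z : ℂ) : τ (Ring.inverse (T (NormedSpace.exp (z • x) * NormedSpace.exp (z • y))) *
      T (NormedSpace.exp (z • x) * x * NormedSpace.exp (z • y))) +
      τ (Ring.inverse (T (NormedSpace.exp (z • x) * NormedSpace.exp (z • y))) *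
      T (NormedSpace.exp (z • x) * (NormedSpace.exp (z • y) * y))) = τ (T x) + τ (T y) := by
    simpa [hone, mul_add] using hτ.logDeriv_map_exp_eq hinv x y isUnit_one z
  simp only [hx, hy] at hxy
  have h1 := τ.hasFDerivAt.comp_hasDerivAt (0 : ℂ)
    ((hasDerivAt_inverse_map_exp hone y).mul (hasDerivAt_map_mul_exp (T := T) y x))
  have h2 := τ.hasFDerivAt.comp_hasDerivAt (0 : ℂ)
    ((hasDerivAt_inverse_map_exp hone x).mul (hasDerivAt_map_exp_mul (T := T) x y))
  have h3 := (h1.add h2).unique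
    ((hasDerivAt_const (0 : ℂ) (τ (T x) + τ (T y))).congr_of_eventuallyEq
      (Eventually.of_forall hxy))
  simp only [zero_smul, NormedSpace.exp_zero, mul_one, one_mul, hone, Ring.inverse_one, map_add,
    neg_mul, map_neg, hτ.map_mul_comm (T y)] at h3
  linear_combination h3 / 2

/-- The Jordan identity holds under a tracial state against the range of the map. -/
theorem IsTracialState.map_sq_mul_eq (hτ : IsTracialState τ) (hone : T 1 = 1)
    (hinv : PreservesInvertibility (T : B →ₗ[ℂ] A)) (x y : B) :
    τ (T (x * x) * T y) = τ (T x * T x * T y) := by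
  have key (z : ℂ) : τ (Ring.inverse (T (NormedSpace.exp (z • x))) *
      T (NormedSpace.exp (z • x) * (x * y))) =
      τ (Ring.inverse (T (NormedSpace.exp (z • x))) * T (NormedSpace.exp (z • x) * x) *
        (Ring.inverse (T (NormedSpace.exp (z • x))) * T (NormedSpace.exp (z • x) * y))) := by
    have hu := isUnit_exp_smul z x
    have hTu : IsUnit (T (NormedSpace.exp (z • x))) := hinv _ hu
    -- The twisted map is again unital, bounded and invertibility-preserving.
    exact hτ.map_mul_eq (T := ContinuousLinearMap.mul ℂ A
      (Ring.inverse (T (NormedSpace.exp (z • x)))) ∘L T ∘L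
        ContinuousLinearMap.mul ℂ B (NormedSpace.exp (z • x)))
      (by simp [Ring.inverse_mul_cancel _ hTu])
      (fun b hb ↦ hTu.ringInverse.mul (hinv _ (hu.mul hb))) x y
  have hR := hasDerivAt_inverse_map_exp hone x
  have h1 := τ.hasFDerivAt.comp_hasDerivAt (0 : ℂ)
    (hR.mul (hasDerivAt_map_exp_mul (T := T) x (x * y)))
  have h2 := τ.hasFDerivAt.comp_hasDerivAt (0 : ℂ)
    ((hR.mul (hasDerivAt_map_exp_mul (T := T) x x)).mul
      (hR.mul (hasDerivAt_map_exp_mul (T := T) x y)))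
  have h3 := h1.unique (h2.congr_of_eventuallyEq (Eventually.of_forall key))
  -- `h5` makes the left side of `h3` vanish; `h4` and `h5` identify `τ (T x * T (x * y))` with `τ
  -- (T (x * x) * T y)`.
  have h4 := hτ.map_mul_eq hone hinv (x * x) y
  have h5 := hτ.map_mul_eq hone hinv x (x * y)
  simp only [Pi.mul_apply, zero_smul, NormedSpace.exp_zero, one_mul, hone, Ring.inverse_one,
    map_add, neg_mul, map_neg, add_mul, mul_add, mul_neg, ← mul_assoc] at h3 h4 h5
  linear_combination h5 - (h3 + h4) / 2

end

/-! ### Faithfulness of the trace and conclusion. -/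

/-- In a simple C*-algebra, a tracial state annihilates no right multiples of a nonzero element. -/
theorem IsTracialState.eq_zero_of_forall_map_mul_eq_zero {A : Type*} [CStarAlgebra A]
    (hsimple : IsSimpleCStarAlgebra A) {τ : A →L[ℂ] ℂ} (hτ : IsTracialState τ) {d : A}
    (hd : ∀ c, τ (d * c) = 0) : d = 0 := by
  let I : TwoSidedIdeal A := TwoSidedIdeal.mk' {a | ∀ c, τ (a * c) = 0} (by simp)
    (fun {x y} hx hy c ↦ by rw [add_mul, map_add, hx, hy, add_zero])
    (fun {x} hx c ↦ by rw [neg_mul, map_neg, hx, neg_zero])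
    (fun {x y} hy c ↦ by rw [mul_assoc, hτ.map_mul_comm, mul_assoc, hy])
    (fun {x y} hx c ↦ by rw [mul_assoc, hx])
  have hI (a : A) : a ∈ I ↔ ∀ c, τ (a * c) = 0 := TwoSidedIdeal.mem_mk' ..
  have hclosed : IsClosed (I : Set A) := by
    have : (I : Set A) = ⋂ c : A, {a | τ (a * c) = 0} := by
      ext a
      simp [hI]
    rw [this]
    exact isClosed_iInter fun c ↦ isClosed_eq (by fun_prop) continuous_const
  rcases hsimple.2 I hclosed with h | h
  · have : d ∈ I := (hI d).2 hd
    rwa [h, TwoSidedIdeal.mem_bot] at this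
  · have h1 : (1 : A) ∈ I := h ▸ trivial
    have h0 : τ = 0 := by
      ext c
      simpa using (hI 1).1 h1 c
    have := hτ.norm_eq_one
    simp [h0] at this

theorem mainTheorem3 {A B : Type*} [CStarAlgebra A]
    [NormedRing B] [NormedAlgebra ℂ B] [CompleteSpace B]
    (hsimple : IsSimpleCStarAlgebra A)
    (htrace : ∃ τ : A →L[ℂ] ℂ, IsTracialState τ)
    (T : B →ₗ[ℂ] A) (hsurj : Function.Surjective T) (hone : T 1 = 1)
    (hinv : PreservesInvertibility T) :
    IsJordanHomomorphism T := by
  obtain ⟨τ, hτ⟩ := htrace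
  let S : B →L[ℂ] A := ⟨T, continuous_of_preservesInvertibility hsurj hone hinv⟩
  intro x
  rw [← sub_eq_zero]
  refine hτ.eq_zero_of_forall_map_mul_eq_zero hsimple fun c ↦ ?_
  obtain ⟨y, rfl⟩ := hsurj c
  rw [sub_mul, map_sub, sub_eq_zero, sq, sq]
  exact hτ.map_sq_mul_eq (T := S) hone hinv x y
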